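/- Let $p$ be a prime, let $\alpha \geq 1$, and let $\mathcal{R} = \mathbb{Z}/p^\alpha\mathbb{Z}$. Let $R \in z^{-1}\mathcal{R}[z]$ be a Laurent polynomial such that $R \bmod p \neq 0$. Factor \[ (R \bmod p) = c\, z^{e_0} R_1^{e_1} \cdots R_k^{e_k}, \] where $k \geq 0$, $c \in \mathbb{F}_p \setminus \{0\}$, $e_0 \in \mathbb{Z}$ (necessarily $e_0 \geq -1$), $e_i \geq 1$ for $1 \leq i \leq k$, and $z, R_1, \dots, R_k \in \mathbb{F}_p[z]$ are distinct, monic, irreducible polynomials. Let \[ t = \max\left(\lfloor \log_p \max(e_0, 1) \rfloor + \alpha,\ \lceil \log_p \max(e_1, \dots, e_k, 1) + 2(\alpha - 1) \rceil\right) \] and $\ell = \operatorname{lcm}(\deg R_1, \dots, \deg R_k)$ (with $\ell = 1$ if $k = 0$). Let $\Lambda_0$ be the $\mathcal{R}$-linear operator on $\mathcal{R}[z, z^{-1}]$ with $\Lambda_0(z^n) = z^{n/p}$ if $p \mid n$ and $\Lambda_0(z^n) = 0$ otherwise, and define $\lambda_0$ on $\mathcal{R}[z, z^{-1}]$ by $\lambda_0(S)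 = \Lambda_0\!\left(S R^{p^\alpha - p^{\alpha - 1}}\right)$. For a Laurent polynomial, let $\operatorname{mindeg}$ and $\deg$ denote the smallest and the largest exponent of $z$ with a nonzero coefficient (with $\operatorname{mindeg} 0 = +\infty$ and $\deg 0 = -\infty$). Then for every $S \in \mathcal{R}[z, z^{-1}]$ with $1 - p^{\alpha - 1} \leq \operatorname{mindeg} S$ and $\deg S \leq p^{\alpha - 1} \deg(R \bmod p)$, the orbit $S, \lambda_0(S), \lambda_0^2(S), \dots$ of $S$ under $\lambda_0$ has at most $t + \ell$ distinct terms. -/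

import Mathlib

open scoped LaurentPolynomial

noncomputable section

namespace CartierOrbit

/-- The smallest exponent of a monomial of `S` with a nonzero coefficient (`⊤` if `S = 0`). -/
def mindeg {A : Type*} [Semiring A] (S : A[T;T⁻¹]) : WithTop ℤ :=
  S.coeff.support.min

/-- The Cartier operator `Λ_r` on Laurent polynomials: the linear extension of
`z ^ n ↦ z ^ ((n - r) / p)` if `n ≡ r mod p`, and `z ^ n ↦ 0` otherwise. -/
def cartier {A : Type*} [Semiring A] (p r : ℕ) (S : A[T;T⁻¹]) : A[T;T⁻¹] :=
  S.coeff.sum fun n a =>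
    if n ≡ (r : ℤ) [ZMOD (p : ℤ)] then
      LaurentPolynomial.C a * LaurentPolynomial.T ((n - r) / p)
    else 0

/-- The coefficient of `z ^ n` in `Λ_r(S)` is the coefficient of `z ^ (p n + r)` in `S`. -/
theorem cartier_coeff {A : Type*} [Semiring A] {p : ℕ} (hp : p ≠ 0) (r : ℕ) (S : A[T;T⁻¹])
    (n : ℤ) : (cartier p r S).coeff n = S.coeff (p * n + r) := by
  have hp' : (p : ℤ) ≠ 0 := by exact_mod_cast hp
  unfold cartier Finsupp.sum
  rw [AddMonoidAlgebra.coeff_sum, Finsupp.finsetSum_apply]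
  rw [Finset.sum_eq_single ((p : ℤ) * n + r)]
  · have h : ((p : ℤ) * n + r) ≡ (r : ℤ) [ZMOD (p : ℤ)] := by
      simp [Int.ModEq]
    beta_reduce
    rw [if_pos h, add_sub_cancel_right, Int.mul_ediv_cancel_left _ hp',
      ← LaurentPolynomial.single_eq_C_mul_T]
    exact Finsupp.single_eq_same
  · intro b _ hb
    beta_reduce
    split_ifs with h
    · obtain ⟨c, hc⟩ := (Int.modEq_iff_dvd.mp h.symm)
      have hb' : b = p * c + r := by linarith
      have hcn : c ≠ n := by
        rintro rfl
        exact hb hb'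
      rw [hb', add_sub_cancel_right, Int.mul_ediv_cancel_left _ hp',
        ← LaurentPolynomial.single_eq_C_mul_T]
      exact Finsupp.single_eq_of_ne hcn.symm
    · simp
  · intro h
    have h0 : S.coeff ((p : ℤ) * n + r) = 0 := by simpa using h
    simp [h0]

/-- Coefficientwise reduction modulo `p` of a Laurent polynomial over `ℤ / p ^ α`, `α ≠ 0`. -/
def modP (p : ℕ) {α : ℕ} (hα : α ≠ 0) : (ZMod (p ^ α))[T;T⁻¹] →+* (ZMod p)[T;T⁻¹] :=
  AddMonoidAlgebra.mapRingHom ℤ (ZMod.castHom (dvd_pow_self p hα) (ZMod p))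

/-- The operator `λ₀(S) = Λ₀(S R ^ (p ^ α - p ^ (α - 1)))`. -/
def lambda0 (p α : ℕ) (R S : (ZMod (p ^ α))[T;T⁻¹]) : (ZMod (p ^ α))[T;T⁻¹] :=
  cartier p 0 (S * R ^ (p ^ α - p ^ (α - 1)))

/-- The number of distinct terms of the sequence `x, f x, f (f x), …`. -/
def orbitSize {X : Type*} (f : X → X) (x : X) : ℕ∞ :=
  (Set.range fun n : ℕ => f^[n] x).encard

/-- `F = c z ^ e₀ R₁ ^ e₁ ⋯ R_k ^ e_k` is the factorization into irreducibles of the nonzero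
Laurent polynomial `F`: `c ≠ 0`, the polynomials `z, R₁, …, R_k` are distinct, monic and
irreducible, and `e_i ≥ 1` for `1 ≤ i ≤ k`. -/
structure IsFactorization {K : Type*} [Field K] (F : K[T;T⁻¹]) (c : K) (e₀ : ℤ) {k : ℕ}
    (P : Fin k → Polynomial K) (e : Fin k → ℕ) : Prop where
  c_ne_zero : c ≠ 0
  monic : ∀ i, (P i).Monic
  irreducible : ∀ i, Irreducible (P i)
  ne_X : ∀ i, P i ≠ Polynomial.X
  injective : Function.Injective P
  one_le : ∀ i, 1 ≤ e i
  eq_prod : F = LaurentPolynomial.C c * LaurentPolynomial.T e₀ *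
    ∏ i, Polynomial.toLaurent (P i) ^ e i

/-- The transient bound
`max (⌊log_p (max (e₀, 1))⌋ + α, ⌈log_p (max (e₁, …, e_k, 1)) + 2 (α - 1)⌉)`. -/
def transient (p α : ℕ) (e₀ : ℤ) {k : ℕ} (e : Fin k → ℕ) : ℕ :=
  max (⌊Real.logb p ((max e₀ 1 : ℤ) : ℝ)⌋₊ + α)
    ⌈Real.logb p ((max (Finset.univ.sup e) 1 : ℕ) : ℝ) + 2 * ((α : ℝ) - 1)⌉₊

end CartierOrbit

end

/-! Put q = p ^ (α - 1). Since R ^ (p q) = (R ^ q)(z ^ p) in ℤ/p^α, applying λ₀ to S amounts to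
keeping every p-th coefficient of a series F = S / R ^ q (`act_lambda0`). It remains to make such an
F eventually periodic.

A cofactor K with R ^ q * K = z ^ L - 1 and L = (p ^ ℓ - 1) p ^ t (`exists_cofactor`) gives F = S K
/ (z ^ L - 1). The degree bounds on S and K make F vanish at exponents ≤ -p ^ t and have period L on
positive exponents. Hence F (p ^ (t + ℓ) m) = F (p ^ t m) for all m, so the iterates t + ℓ and t of
λ₀ agree on S (`lambda0_iterate_eq`). -/

namespace CartierOrbit

open LaurentPolynomial

/-! ### Two-sided series as a module over Laurent polynomials -/

/-- Translation `(F ↦ F (· - n))` on functions `ℤ → A`, as a monoid homomorphism in `n`. -/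
noncomputable def shift (A : Type*) [CommRing A] : Multiplicative ℤ →* Module.End A (ℤ → A) where
  toFun n :=
    { toFun := fun F m => F (m - n.toAdd)
      map_add' := fun _ _ => rfl
      map_smul' := fun _ _ => rfl }
  map_one' := by ext; simp
  map_mul' a b := by
    apply LinearMap.ext
    intro F
    funext m
    simp [sub_sub]

/-- The convolution action of Laurent polynomials on functions `ℤ → A`, which are regarded as
doubly infinite formal series. -/
noncomputable def act (A : Type*) [CommRing A] : A[T;T⁻¹] →ₐ[A] Module.End A (ℤ → A) :=
  AddMonoidAlgebra.lift A (Module.End A (ℤ → A)) ℤ (shift A)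

variable {A : Type*} [CommRing A]

theorem act_single (j : ℤ) (a : A) (F : ℤ → A) (m : ℤ) :
    act A (.single j a) F m = a * F (m - j) := by
  rw [act, AddMonoidAlgebra.lift_single]
  rfl

theorem act_mul (P Q : A[T;T⁻¹]) (F : ℤ → A) : act A (P * Q) F = act A P (act A Q F) := by
  simp

theorem act_T (j : ℤ) (F : ℤ → A) (m : ℤ) : act A (T j) F m = F (m - j) := by
  rw [T, act_single, one_mul]

theorem act_apply (P : A[T;T⁻¹]) (F : ℤ → A) (m : ℤ) :
    act A P F m = ∑ j ∈ P.coeff.support, P.coeff j * F (m - j) := by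
  simp [act, AddMonoidAlgebra.lift_apply, shift, Finsupp.sum, LinearMap.sum_apply,
    Finset.sum_apply]

theorem act_coeff (P Q : A[T;T⁻¹]) : act A P Q.coeff = (P * Q).coeff := by
  induction P using AddMonoidAlgebra.induction_linear with
  | zero => simp
  | add P P' h h' => rw [map_add, LinearMap.add_apply, h, h', add_mul]; rfl
  | single j a =>
    funext m
    rw [act_single, AddMonoidAlgebra.coeff_single_mul_apply]
    congr 2
    ring

/-- The ring homomorphism `z ↦ z ^ p` of Laurent polynomials. -/
noncomputable def expand (A : Type*) [CommRing A] (p : ℕ) : A[T;T⁻¹] →+* A[T;T⁻¹] :=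
  AddMonoidAlgebra.mapDomainRingHom A (AddMonoidHom.mulLeft (p : ℤ))

theorem expand_single (p : ℕ) (j : ℤ) (a : A) :
    expand A p (.single j a) = .single (p * j) a := by
  rw [expand, AddMonoidAlgebra.mapDomainRingHom_apply, AddMonoidAlgebra.mapDomain_single]
  rfl

theorem act_expand (p : ℕ) (P : A[T;T⁻¹]) (F : ℤ → A) (n : ℤ) :
    act A (expand A p P) F (p * n) = act A P (fun m => F (p * m)) n := by
  induction P using AddMonoidAlgebra.induction_linear with
  | zero => simp
  | add P P' h h' => simp only [map_add, LinearMap.add_apply, Pi.add_apply, h, h']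
  | single j a => rw [expand_single, act_single, act_single, mul_sub]

theorem expand_zmod (p : ℕ) [Fact p.Prime] (P : (ZMod p)[T;T⁻¹]) : expand (ZMod p) p P = P ^ p := by
  have : CharP (ZMod p)[T;T⁻¹] p := charP_of_injective_algebraMap
    (algebraMap (ZMod p) (ZMod p)[T;T⁻¹]).injective p
  have h : expand (ZMod p) p = frobenius (ZMod p)[T;T⁻¹] p := by
    apply AddMonoidAlgebra.ringHom_ext
    · intro r
      rw [expand_single, frobenius_def, AddMonoidAlgebra.single_pow, ZMod.pow_card]
      simp
    · intro m
      rw [expand_single, frobenius_def, AddMonoidAlgebra.single_pow]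
      simp
  rw [h, frobenius_def]

/-! ### Reduction modulo `p` and decimation of series -/

section Reduction

variable {p α : ℕ}

theorem modP_coeff (hα : α ≠ 0) (X : (ZMod (p ^ α))[T;T⁻¹]) (n : ℤ) :
    (modP p hα X).coeff n = ZMod.castHom (dvd_pow_self p hα) (ZMod p) (X.coeff n) := by
  rw [modP, AddMonoidAlgebra.coeff_mapRingHom]

theorem modP_single (hα : α ≠ 0) (n : ℤ) (a : ZMod (p ^ α)) :
    modP p hα (.single n a) = .single n (ZMod.castHom (dvd_pow_self p hα) (ZMod p) a) := by
  rw [modP, AddMonoidAlgebra.mapRingHom_single]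

theorem modP_T (hα : α ≠ 0) (n : ℤ) : modP p hα (T n) = T n := by
  rw [T, modP_single, map_one, T]

theorem modP_expand (hα : α ≠ 0) (X : (ZMod (p ^ α))[T;T⁻¹]) :
    modP p hα (expand _ p X) = expand _ p (modP p hα X) :=
  congr($(AddMonoidAlgebra.mapRingHom_comp_mapDomainRingHom
    (ZMod.castHom (dvd_pow_self p hα) (ZMod p)) (AddMonoidHom.mulLeft (p : ℤ))) X)

theorem dvd_of_castHom_eq_zero [NeZero p] (hα : α ≠ 0) (a : ZMod (p ^ α))
    (h : ZMod.castHom (dvd_pow_self p hα) (ZMod p) a = 0) : (p : ZMod (p ^ α)) ∣ a := by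
  obtain ⟨n, rfl⟩ := ZMod.natCast_zmod_surjective a
  rw [map_natCast, ZMod.natCast_eq_zero_iff] at h
  exact Nat.cast_dvd_cast h

theorem dvd_of_modP_eq_zero [NeZero p] (hα : α ≠ 0) (X : (ZMod (p ^ α))[T;T⁻¹])
    (h : modP p hα X = 0) : (p : (ZMod (p ^ α))[T;T⁻¹]) ∣ X := by
  have hX : X = ∑ n ∈ X.coeff.support, AddMonoidAlgebra.single n (X.coeff n) := by
    apply AddMonoidAlgebra.coeff_injective
    rw [AddMonoidAlgebra.coeff_sum]
    exact (Finsupp.sum_single X.coeff).symm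
  rw [hX]
  refine Finset.dvd_sum fun n _ => ?_
  have hn : ZMod.castHom (dvd_pow_self p hα) (ZMod p) (X.coeff n) = 0 := by
    rw [← modP_coeff hα, h]; rfl
  obtain ⟨b, hb⟩ := dvd_of_castHom_eq_zero hα _ hn
  refine ⟨.single n b, ?_⟩
  rw [hb, ← nsmul_eq_mul, ← nsmul_eq_mul, AddMonoidAlgebra.smul_single]

/-- Each `p`-th power gains a factor `p` in a congruence, so `α - 1` of them turn a congruence
modulo `p` into one modulo `p ^ α = 0`. -/
theorem pow_eq_of_modP_eq [NeZero p] (hα : α ≠ 0) {X Y : (ZMod (p ^ α))[T;T⁻¹]}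
    (h : modP p hα X = modP p hα Y) : X ^ p ^ (α - 1) = Y ^ p ^ (α - 1) := by
  have h1 := dvd_sub_pow_of_dvd_sub
    (dvd_of_modP_eq_zero hα (X - Y) (by rw [map_sub, h, sub_self])) (α - 1)
  rw [Nat.sub_add_cancel (Nat.one_le_iff_ne_zero.mpr hα)] at h1
  have h0 : ((p : (ZMod (p ^ α))[T;T⁻¹]) ^ α) = 0 := by
    rw [← Nat.cast_pow, ← map_natCast (C : ZMod (p ^ α) →+* _), ZMod.natCast_self, map_zero]
  rw [h0, zero_dvd_iff, sub_eq_zero] at h1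
  exact h1

theorem pow_pow_eq_expand_pow [Fact p.Prime] (hα : α ≠ 0) (X : (ZMod (p ^ α))[T;T⁻¹]) :
    X ^ p ^ α = expand _ p (X ^ p ^ (α - 1)) := by
  have h : modP p hα (X ^ p) = modP p hα (expand _ p X) := by
    rw [modP_expand, expand_zmod, map_pow]
  rw [map_pow, ← pow_eq_of_modP_eq hα h, ← pow_mul, ← pow_succ',
    Nat.sub_add_cancel (Nat.one_le_iff_ne_zero.mpr hα)]

/-- If `F` is a doubly infinite series representing `S / R ^ (p ^ (α - 1))`, then `F (p ·)`
represents `λ₀(S) / R ^ (p ^ (α - 1))`. -/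
theorem act_lambda0 [Fact p.Prime] (hα : α ≠ 0) (R S : (ZMod (p ^ α))[T;T⁻¹])
    (F : ℤ → ZMod (p ^ α)) (hF : act _ (R ^ p ^ (α - 1)) F = S.coeff) :
    act _ (R ^ p ^ (α - 1)) (fun m => F (p * m)) = (lambda0 p α R S).coeff := by
  funext n
  have hle : p ^ (α - 1) ≤ p ^ α := Nat.pow_le_pow_right (Nat.Prime.pos Fact.out) (Nat.sub_le _ _)
  have hpow : R ^ p ^ α = R ^ (p ^ α - p ^ (α - 1)) * R ^ p ^ (α - 1) := by
    rw [← pow_add, Nat.sub_add_cancel hle]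
  rw [← act_expand, ← pow_pow_eq_expand_pow hα, hpow, act_mul, hF, act_coeff, mul_comm, lambda0,
    cartier_coeff (Nat.Prime.ne_zero Fact.out), Nat.cast_zero, add_zero]

theorem act_lambda0_iterate [Fact p.Prime] (hα : α ≠ 0) (R S : (ZMod (p ^ α))[T;T⁻¹])
    (F : ℤ → ZMod (p ^ α)) (hF : act _ (R ^ p ^ (α - 1)) F = S.coeff) (n : ℕ) :
    act _ (R ^ p ^ (α - 1)) (fun m => F (p ^ n * m)) = ((lambda0 p α R)^[n] S).coeff := by
  induction n with
  | zero => simpa using hF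
  | succ n ih =>
    rw [Function.iterate_succ_apply', ← act_lambda0 hα R _ _ ih]
    simp only [pow_succ, mul_assoc]

end Reduction

/-! ### Bounds on exponents -/

section Support

/-- All exponents of `P` lie between `a` and `b`. -/
def SuppIn (a b : ℤ) (P : A[T;T⁻¹]) : Prop := ∀ n, P.coeff n ≠ 0 → a ≤ n ∧ n ≤ b

theorem SuppIn.mono {a b a' b' : ℤ} {P : A[T;T⁻¹]} (h : SuppIn a b P) (ha : a' ≤ a)
    (hb : b ≤ b') : SuppIn a' b' P :=
  fun n hn => ⟨ha.trans (h n hn).1, (h n hn).2.trans hb⟩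

theorem suppIn_single (j : ℤ) (a : A) : SuppIn j j (.single j a : A[T;T⁻¹]) := by
  intro n hn
  rw [AddMonoidAlgebra.coeff_single, Finsupp.single_apply] at hn
  have : j = n := by by_contra h; simp [h] at hn
  omega

theorem suppIn_T (j : ℤ) : SuppIn j j (T j : A[T;T⁻¹]) := suppIn_single j 1

theorem suppIn_C (a : A) : SuppIn 0 0 (C a : A[T;T⁻¹]) := suppIn_single 0 a

theorem suppIn_zero (a b : ℤ) : SuppIn a b (0 : A[T;T⁻¹]) := fun _ hn => absurd rfl hn

theorem SuppIn.add {a b : ℤ} {P Q : A[T;T⁻¹]} (hP : SuppIn a b P) (hQ : SuppIn a b Q) :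
    SuppIn a b (P + Q) := by
  intro n hn
  by_cases h : P.coeff n = 0
  · exact hQ n fun h' => hn (by simp [h, h'])
  · exact hP n h

theorem SuppIn.neg {a b : ℤ} {P : A[T;T⁻¹]} (hP : SuppIn a b P) : SuppIn a b (-P) := by
  intro n hn
  exact hP n fun h' => hn (by simp [h'])

theorem SuppIn.sum {ι : Type*} {s : Finset ι} {f : ι → A[T;T⁻¹]} {a b : ℤ}
    (h : ∀ i ∈ s, SuppIn a b (f i)) : SuppIn a b (∑ i ∈ s, f i) :=
  Finset.sum_induction f (SuppIn a b) (fun _ _ => SuppIn.add) (suppIn_zero a b) h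

theorem SuppIn.mul {a b c d : ℤ} {P Q : A[T;T⁻¹]} (hP : SuppIn a b P) (hQ : SuppIn c d Q) :
    SuppIn (a + c) (b + d) (P * Q) := by
  intro n hn
  rw [← act_coeff, act_apply] at hn
  obtain ⟨j, -, hj⟩ := Finset.exists_ne_zero_of_sum_ne_zero hn
  have h1 := hP j (left_ne_zero_of_mul hj)
  have h2 := hQ _ (right_ne_zero_of_mul hj)
  omega

theorem SuppIn.pow {a b : ℤ} {P : A[T;T⁻¹]} (hP : SuppIn a b P) (n : ℕ) :
    SuppIn (n * a) (n * b) (P ^ n) := by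
  induction n with
  | zero => simpa using suppIn_C (A := A) 1
  | succ n ih =>
    rw [pow_succ]
    exact (ih.mul hP).mono (by push_cast; linarith) (by push_cast; linarith)

theorem suppIn_toLaurent (f : Polynomial A) :
    SuppIn 0 f.natDegree (Polynomial.toLaurent f) := by
  rw [f.as_sum_range, map_sum]
  refine SuppIn.sum fun i hi => ?_
  rw [← Polynomial.C_mul_X_pow_eq_monomial, Polynomial.toLaurent_C_mul_X_pow,
    ← single_eq_C_mul_T]
  rw [Finset.mem_range] at hi
  rw [← f.as_sum_range]
  exact (suppIn_single _ _).mono (by omega) (by omega)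

theorem SuppIn.of_mindeg_of_degree {a b : ℤ} {P : A[T;T⁻¹]} (ha : (a : WithTop ℤ) ≤ mindeg P)
    (hb : P.degree ≤ (b : WithBot ℤ)) : SuppIn a b P := by
  intro n hn
  have hn' : n ∈ P.coeff.support := by simpa using hn
  exact ⟨WithTop.coe_le_coe.mp (ha.trans (Finset.min_le hn')),
    WithBot.coe_le_coe.mp ((Finset.le_max hn').trans hb)⟩

theorem SuppIn.degree_le {a b : ℤ} {P : A[T;T⁻¹]} (h : SuppIn a b P) :
    P.degree ≤ (b : WithBot ℤ) :=
  Finset.max_le fun n hn => WithBot.coe_le_coe.mpr (h n (by simpa using hn)).2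

end Support

/-! ### Arithmetic of the transient and of binomial coefficients -/

/-- The only properties of `t` that are used: the first two serve to construct the cofactor, the
last controls negative exponents. -/
theorem transient_spec (p : ℕ) [Fact p.Prime] (α : ℕ) (hα : α ≠ 0) (e₀ : ℤ) {k : ℕ}
    (e : Fin k → ℕ) {t : ℕ} (ht : transient p α e₀ e ≤ t) :
    2 * (α - 1) ≤ t ∧ (∀ i, e i ≤ p ^ (t - 2 * (α - 1))) ∧
      (p : ℤ) ^ (α - 1) * (e₀ + 1) ≤ (p : ℤ) ^ t := by
  have hp : 1 < (p : ℝ) := by exact_mod_cast Nat.Prime.one_lt Fact.out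
  obtain ⟨β, rfl⟩ : ∃ β, α = β + 1 := Nat.exists_eq_succ_of_ne_zero hα
  obtain ⟨h1, h2⟩ := max_le_iff.mp ht
  simp only [Nat.add_sub_cancel] at h1 h2 ⊢
  set E : ℕ := max (Finset.univ.sup e) 1 with hE
  have hE1 : (1 : ℝ) ≤ (E : ℝ) := by exact_mod_cast le_max_right _ _
  have hlog : 0 ≤ Real.logb p E := Real.logb_nonneg hp hE1
  have h3 : Real.logb p E + 2 * (β : ℝ) ≤ t := by
    have := Nat.ceil_le.mp h2
    push_cast at this
    linarith
  have hβ : 2 * β ≤ t := by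
    have : (2 * β : ℝ) ≤ t := by linarith
    exact_mod_cast this
  refine ⟨hβ, fun i => ?_, ?_⟩
  · have h4 : Real.logb p E ≤ ((t - 2 * β : ℕ) : ℝ) := by
      rw [Nat.cast_sub hβ]
      push_cast
      linarith
    rw [Real.logb_le_iff_le_rpow hp (by linarith), Real.rpow_natCast] at h4
    have h5 : E ≤ p ^ (t - 2 * β) := by exact_mod_cast h4
    exact ((Finset.le_sup (Finset.mem_univ i)).trans (le_max_left _ _)).trans h5
  · set m : ℤ := max e₀ 1 with hm
    have hm1 : (1 : ℤ) ≤ m := le_max_right _ _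
    have hm0 : (0 : ℝ) < (m : ℝ) := by exact_mod_cast hm1
    obtain ⟨u, rfl⟩ := Nat.exists_eq_add_of_le (show β ≤ t by omega)
    -- The floor makes this strict, which absorbs the `+ 1` in `e₀ + 1`.
    have h4 : Real.logb p m < (u : ℝ) := by
      refine (Nat.lt_floor_add_one _).trans_le ?_
      have : ⌊Real.logb p m⌋₊ + 1 ≤ u := by omega
      exact_mod_cast this
    rw [Real.logb_lt_iff_lt_rpow hp hm0, Real.rpow_natCast] at h4
    have h5 : m < (p : ℤ) ^ u := by exact_mod_cast h4
    rw [pow_add]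
    have : e₀ ≤ m := le_max_left _ _
    exact mul_le_mul_of_nonneg_left (by omega) (by positivity)

/-- The valuation of the binomial coefficient is `2 * β` minus that of `i`, and the latter is less
than `β`. -/
theorem pow_dvd_choose {p β i : ℕ} (hp : p.Prime) (hi : i ≠ 0) (hlt : i < p ^ β) :
    p ^ (β + 1) ∣ (p ^ (2 * β)).choose i := by
  have hle : i ≤ p ^ (2 * β) := hlt.le.trans (Nat.pow_le_pow_right hp.pos (by omega))
  have h := Nat.factorization_choose_prime_pow_add_factorization hp hle hi
  have h' : i.factorization p < β := by
    by_contra hβ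
    exact absurd (Nat.le_of_dvd (Nat.pos_of_ne_zero hi)
      ((hp.pow_dvd_iff_le_factorization hi).mpr (not_lt.mp hβ))) (not_le.mpr hlt)
  exact (hp.pow_dvd_iff_le_factorization (Nat.choose_pos hle).ne').mpr (by omega)

/-- `(z ^ M - 1) ^ (p ^ β)` divides `z ^ (M p ^ (2 β)) - 1` modulo `p ^ (β + 1)`. -/
theorem exists_mul_eq_T_sub_one (p : ℕ) [Fact p.Prime] {α : ℕ} (hα : α ≠ 0) (M : ℕ) :
    ∃ H : (ZMod (p ^ α))[T;T⁻¹],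
      SuppIn 0 (((p : ℤ) ^ (2 * (α - 1)) - (p : ℤ) ^ (α - 1)) * M) H ∧
      (T M - 1) ^ p ^ (α - 1) * H = T ((p : ℤ) ^ (2 * (α - 1)) * M) - 1 := by
  have hp : p.Prime := Fact.out
  obtain ⟨β, rfl⟩ : ∃ β, α = β + 1 := Nat.exists_eq_succ_of_ne_zero hα
  simp only [Nat.add_sub_cancel]
  obtain ⟨d, hd⟩ := Nat.exists_eq_add_of_le
    (Nat.pow_le_pow_right hp.pos (show β ≤ 2 * β by omega))
  have hd' : (p : ℤ) ^ (2 * β) = (p : ℤ) ^ β + d := by exact_mod_cast hd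
  have hsupp : SuppIn 0 M (T M - 1 : (ZMod (p ^ (β + 1)))[T;T⁻¹]) := by
    rw [sub_eq_add_neg, ← T_zero]
    exact ((suppIn_T _).mono (by positivity) le_rfl).add
      ((suppIn_T 0).neg.mono le_rfl (by positivity))
  -- Expand `((T M - 1) + 1) ^ p ^ (2 * β)`: the terms of index strictly between `0` and `p ^ β`
  -- vanish, and the later ones contain `(T M - 1) ^ p ^ β`.
  refine ⟨∑ i ∈ Finset.range (d + 1), (T M - 1) ^ i *
    C (((p ^ (2 * β)).choose (p ^ β + i) : ℕ) : ZMod (p ^ (β + 1))), SuppIn.sum fun i hi => ?_, ?_⟩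
  · rw [Finset.mem_range] at hi
    refine ((hsupp.pow i).mul (suppIn_C _)).mono (by simp) ?_
    rw [hd', add_zero, add_sub_cancel_left]
    exact mul_le_mul_of_nonneg_right (by omega) (by positivity)
  · have key := add_pow (T M - 1 : (ZMod (p ^ (β + 1)))[T;T⁻¹]) 1 (p ^ (2 * β))
    rw [sub_add_cancel, T_pow] at key
    push_cast at key
    have hsplit : p ^ (2 * β) + 1 = p ^ β + (d + 1) := by omega
    have h0 : ∑ i ∈ Finset.range (p ^ β), (T M - 1 : (ZMod (p ^ (β + 1)))[T;T⁻¹]) ^ i *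
        1 ^ (p ^ (2 * β) - i) * ((p ^ (2 * β)).choose i : (ZMod (p ^ (β + 1)))[T;T⁻¹]) = 1 := by
      rw [Finset.sum_eq_single_of_mem 0 (Finset.mem_range.mpr (pow_pos hp.pos β))]
      · simp
      · intro i hi hi0
        have hz : (((p ^ (2 * β)).choose i : ℕ) : ZMod (p ^ (β + 1))) = 0 :=
          (ZMod.natCast_eq_zero_iff _ _).mpr (pow_dvd_choose hp hi0 (Finset.mem_range.mp hi))
        rw [← map_natCast (C : ZMod (p ^ (β + 1)) →+* _), hz, map_zero, mul_zero]
    rw [key, hsplit, Finset.sum_range_add _ (p ^ β) (d + 1), h0, add_sub_cancel_left,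
      Finset.mul_sum]
    refine Finset.sum_congr rfl fun i _ => ?_
    rw [map_natCast, one_pow, mul_one, pow_add (T (M : ℤ) - 1), ← mul_assoc]

/-! ### The cofactor `K` -/

section Factorization

open Polynomial in
theorem irreducible_dvd_X_pow_sub_one {p : ℕ} [Fact p.Prime] {f : (ZMod p)[X]}
    (hf : Irreducible f) (hm : f.Monic) (hX : f ≠ X) {ℓ : ℕ} (hdvd : f.natDegree ∣ ℓ) :
    f ∣ X ^ (p ^ ℓ - 1) - 1 := by
  have h := hf.natDegree_dvd_iff_dvd_X_pow_card_pow_sub_X.mp hdvd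
  rw [Nat.card_zmod] at h
  have h1 : (X ^ p ^ ℓ - X : (ZMod p)[X]) = X * (X ^ (p ^ ℓ - 1) - 1) := by
    rw [mul_sub, ← pow_succ', Nat.sub_add_cancel (Nat.one_le_pow _ _ (Nat.Prime.pos Fact.out)),
      mul_one]
  rw [h1] at h
  refine (hf.prime.dvd_or_dvd h).resolve_left fun hd => hX ?_
  exact eq_of_monic_of_associated hm monic_X (hf.associated_of_dvd irreducible_X hd)

open Polynomial in
theorem prod_pow_dvd_X_pow_sub_one {p : ℕ} [Fact p.Prime] {F : (ZMod p)[T;T⁻¹]} {c : ZMod p}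
    {e₀ : ℤ} {k : ℕ} {P : Fin k → (ZMod p)[X]} {e : Fin k → ℕ} (hfac : IsFactorization F c e₀ P e)
    {s : ℕ} (hs : ∀ i, e i ≤ p ^ s) {ℓ : ℕ} (hℓ : ∀ i, (P i).natDegree ∣ ℓ) :
    ∏ i, P i ^ e i ∣ X ^ ((p ^ ℓ - 1) * p ^ s) - 1 := by
  -- By Frobenius, every irreducible factor of `X ^ (p ^ ℓ - 1) - 1` acquires multiplicity at least
  -- `p ^ s`.
  have h1 : (X ^ ((p ^ ℓ - 1) * p ^ s) - 1 : (ZMod p)[X]) = (X ^ (p ^ ℓ - 1) - 1) ^ p ^ s := by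
    rw [sub_pow_char_pow, one_pow, pow_mul]
  rw [h1]
  refine Finset.prod_dvd_of_coprime ?_ fun i _ => ?_
  · intro i _ j _ hij
    refine IsCoprime.pow ?_
    refine ((hfac.irreducible i).coprime_iff_not_dvd).mpr fun hd => hij (hfac.injective ?_)
    exact eq_of_monic_of_associated (hfac.monic i) (hfac.monic j)
      ((hfac.irreducible i).associated_of_dvd (hfac.irreducible j) hd)
  · exact (pow_dvd_pow _ (hs i)).trans (pow_dvd_pow_of_dvd
      (irreducible_dvd_X_pow_sub_one (hfac.irreducible i) (hfac.monic i) (hfac.ne_X i) (hℓ i)) _)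

theorem exists_cofactor_zmod {p : ℕ} [Fact p.Prime] {F : (ZMod p)[T;T⁻¹]} {c : ZMod p}
    {e₀ : ℤ} {k : ℕ} {P : Fin k → Polynomial (ZMod p)} {e : Fin k → ℕ}
    (hfac : IsFactorization F c e₀ P e) {r : ℤ} (hr : F.degree = (r : WithBot ℤ))
    {s : ℕ} (hs : ∀ i, e i ≤ p ^ s) {ℓ : ℕ} (hℓ0 : ℓ ≠ 0) (hℓ : ∀ i, (P i).natDegree ∣ ℓ) :
    ∃ G : (ZMod p)[T;T⁻¹], SuppIn (-e₀) (((p ^ ℓ - 1) * p ^ s : ℕ) - r) G ∧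
      F * G = T ((p ^ ℓ - 1) * p ^ s : ℕ) - 1 := by
  have hp : p.Prime := Fact.out
  obtain ⟨G, hG⟩ := prod_pow_dvd_X_pow_sub_one hfac hs hℓ
  set M := (p ^ ℓ - 1) * p ^ s with hM
  have hM0 : 0 < M := Nat.mul_pos (Nat.sub_pos_of_lt (Nat.one_lt_pow hℓ0 hp.one_lt))
    (pow_pos hp.pos s)
  set Q : Polynomial (ZMod p) := ∏ i, P i ^ e i with hQ
  have hQm : Q.Monic := Polynomial.monic_prod_of_monic _ _ fun i _ => (hfac.monic i).pow _
  have hF : F = C c * T e₀ * Polynomial.toLaurent Q := by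
    rw [hfac.eq_prod, hQ, map_prod]
    simp only [map_pow]
  have hGdeg : M = Q.natDegree + G.natDegree := by
    have hne : (Polynomial.X ^ M - 1 : Polynomial (ZMod p)) ≠ 0 :=
      Polynomial.X_pow_sub_C_ne_zero hM0 1
    have h := congrArg Polynomial.natDegree hG
    rw [hQm.natDegree_mul' (by rintro rfl; simp [hne] at hG)] at h
    rw [← h]
    exact (Polynomial.natDegree_X_pow_sub_C (r := 1)).symm
  have hr' : r ≤ e₀ + Q.natDegree := by
    have h : SuppIn (0 + e₀ + 0) (0 + e₀ + Q.natDegree) F := by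
      rw [hF]
      exact ((suppIn_C _).mul (suppIn_T _)).mul (suppIn_toLaurent _)
    have h' := h.degree_le
    rw [hr, WithBot.coe_le_coe] at h'
    omega
  refine ⟨C c⁻¹ * T (-e₀) * Polynomial.toLaurent G, ?_, ?_⟩
  · refine (((suppIn_C _).mul (suppIn_T _)).mul (suppIn_toLaurent _)).mono (by omega) ?_
    rw [hGdeg]
    push_cast
    omega
  · have h1 : (C c * C c⁻¹ : (ZMod p)[T;T⁻¹]) = 1 := by
      rw [← map_mul, mul_inv_cancel₀ hfac.c_ne_zero, map_one]
    have h2 : (T e₀ * T (-e₀) : (ZMod p)[T;T⁻¹]) = 1 := by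
      rw [← T_add, add_neg_cancel, T_zero]
    calc F * (C c⁻¹ * T (-e₀) * Polynomial.toLaurent G)
        = (C c * C c⁻¹) * (T e₀ * T (-e₀)) * Polynomial.toLaurent (Q * G) := by
          rw [hF, map_mul]; ring
      _ = T M - 1 := by
          rw [h1, h2, ← hG, one_mul, one_mul, map_sub, Polynomial.toLaurent_X_pow, map_one]

theorem exists_lift {p : ℕ} [NeZero p] {α : ℕ} (hα : α ≠ 0) {a b : ℤ} {G : (ZMod p)[T;T⁻¹]}
    (hG : SuppIn a b G) : ∃ G' : (ZMod (p ^ α))[T;T⁻¹], SuppIn a b G' ∧ modP p hα G' = G := by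
  choose f hf using ZMod.castHom_surjective (dvd_pow_self p hα)
  refine ⟨∑ n ∈ G.coeff.support, .single n (f (G.coeff n)), SuppIn.sum fun n hn => ?_, ?_⟩
  · have h := hG n (by simpa using hn)
    exact (suppIn_single _ _).mono h.1 h.2
  · rw [map_sum]
    simp only [modP_single, hf]
    apply AddMonoidAlgebra.coeff_injective
    rw [AddMonoidAlgebra.coeff_sum]
    exact Finsupp.sum_single G.coeff

/-- A cofactor modulo `p` is lifted, raised to the power `p ^ (α - 1)` to become exact, and
multiplied by the quotient from `exists_mul_eq_T_sub_one`; this last step costs the summand `2 * (α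
- 1)` in `t`. -/
theorem exists_cofactor {p : ℕ} [Fact p.Prime] {α : ℕ} (hα : α ≠ 0)
    {R : (ZMod (p ^ α))[T;T⁻¹]} {c : ZMod p} {e₀ : ℤ} {k : ℕ} {P : Fin k → Polynomial (ZMod p)}
    {e : Fin k → ℕ} (hfac : IsFactorization (modP p hα R) c e₀ P e) {r : ℤ}
    (hr : (modP p hα R).degree = (r : WithBot ℤ)) {t : ℕ} (ht : transient p α e₀ e ≤ t)
    {ℓ : ℕ} (hℓ0 : ℓ ≠ 0) (hℓ : ∀ i, (P i).natDegree ∣ ℓ) :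
    ∃ K : (ZMod (p ^ α))[T;T⁻¹],
      SuppIn (-((p : ℤ) ^ (α - 1) * e₀))
        (((p : ℤ) ^ ℓ - 1) * (p : ℤ) ^ t - (p : ℤ) ^ (α - 1) * r) K ∧
      R ^ p ^ (α - 1) * K = T (((p : ℤ) ^ ℓ - 1) * (p : ℤ) ^ t) - 1 := by
  have hp : p.Prime := Fact.out
  obtain ⟨h2, hs, -⟩ := transient_spec p α hα e₀ e ht
  obtain ⟨s, rfl⟩ := Nat.exists_eq_add_of_le h2
  rw [Nat.add_sub_cancel_left] at hs
  obtain ⟨G, hGs, hG⟩ := exists_cofactor_zmod hfac hr hs hℓ0 hℓ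
  obtain ⟨G', hGs', rfl⟩ := exists_lift hα hGs
  obtain ⟨H, hHs, hH⟩ := exists_mul_eq_T_sub_one p hα ((p ^ ℓ - 1) * p ^ s)
  have hM : (((p ^ ℓ - 1) * p ^ s : ℕ) : ℤ) = ((p : ℤ) ^ ℓ - 1) * (p : ℤ) ^ s := by
    rw [Nat.cast_mul, Nat.cast_sub (Nat.one_le_pow _ _ hp.pos)]
    push_cast
    rfl
  have hpow : (R * G') ^ p ^ (α - 1) = (T ((p ^ ℓ - 1) * p ^ s : ℕ) - 1) ^ p ^ (α - 1) :=
    pow_eq_of_modP_eq hα (by rw [map_mul, hG, map_sub, modP_T, map_one])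
  refine ⟨G' ^ p ^ (α - 1) * H, ((hGs'.pow _).mul hHs).mono ?_ ?_, ?_⟩
  · push_cast
    linarith
  · rw [hM, pow_add]
    push_cast
    linarith
  · rw [← mul_assoc, ← mul_pow, hpow, hH, hM, pow_add]
    congr 2
    ring

end Factorization

/-! ### Periodicity of the series and of the orbit -/

section Orbit

/-- The expansion of `1 / (z ^ L - 1)` at `z = 0`. -/
def geom (A : Type*) [CommRing A] (L m : ℤ) : A := if 0 ≤ m ∧ L ∣ m then -1 else 0

variable {A : Type*} [CommRing A]

theorem act_T_sub_one_geom {L : ℤ} (hL : 0 < L) :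
    act A (T L - 1) (geom A L) = (1 : A[T;T⁻¹]).coeff := by
  funext m
  have h1 : (1 : A[T;T⁻¹]).coeff m = if 0 = m then 1 else 0 := by
    rw [← T_zero, T_apply]
  rw [map_sub, map_one, LinearMap.sub_apply, Pi.sub_apply, act_T, Module.End.one_apply, h1]
  simp only [geom, dvd_sub_self_right]
  by_cases hd : L ∣ m
  · obtain ⟨n, rfl⟩ := hd
    by_cases hn : n = 0
    · subst hn
      simp [hL]
    · have hne : ¬ (0 = L * n) := by
        intro h
        exact (mul_ne_zero hL.ne' hn) h.symm
      have : 0 ≤ L * n - L ↔ 0 ≤ L * n := by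
        constructor
        · intro h
          linarith
        · intro h
          have h0 : 0 < L * n := lt_of_le_of_ne h hne
          have : 0 < n := pos_of_mul_pos_right h0 hL.le
          nlinarith
      rw [if_neg hne]
      simp only [this, sub_self]
  · have hne : ¬ (0 = m) := by
      rintro rfl
      exact hd (dvd_zero _)
    simp [hd, hne]

/-- The coefficients of `B / (z ^ L - 1)` depend only on the exponent modulo `L`, from the degree
of `B` minus `L` on. -/
theorem act_geom_eq {L b a : ℤ} {B : A[T;T⁻¹]} (hB : SuppIn a b B) {m m' : ℤ}
    (hm : b - L < m) (hm' : b - L < m') (hd : L ∣ m' - m) :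
    act A B (geom A L) m = act A B (geom A L) m' := by
  rw [act_apply, act_apply]
  refine Finset.sum_congr rfl fun j hj => ?_
  have hj := (hB j (by simpa using hj)).2
  -- A multiple of `L` exceeding `-L` is nonnegative, so the cutoff in `geom` plays no role here.
  have key : ∀ x : ℤ, b - L < x → L ∣ x - j → 0 ≤ x - j := by
    rintro x hx ⟨n, hn⟩
    by_contra hlt
    rw [hn, not_le] at hlt
    have hL : -L < L * n := by linarith
    rcases lt_trichotomy L 0 with h | h | h
    · nlinarith
    · simp [h] at hlt
    · have : n < 0 := by
        by_contra h'
        nlinarith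
      nlinarith
  have hiff : L ∣ m - j ↔ L ∣ m' - j := by
    have : m' - j = (m - j) + (m' - m) := by ring
    rw [this, dvd_add_left hd]
  congr 1
  unfold geom
  by_cases h : L ∣ m - j
  · rw [if_pos ⟨key _ hm h, h⟩, if_pos ⟨key _ hm' (hiff.mp h), hiff.mp h⟩]
  · rw [if_neg fun h' => h h'.2, if_neg fun h' => h (hiff.mpr h'.2)]

theorem act_geom_eq_zero {L b a : ℤ} {B : A[T;T⁻¹]} (hB : SuppIn a b B) {m : ℤ} (hm : m < a) :
    act A B (geom A L) m = 0 := by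
  rw [act_apply]
  refine Finset.sum_eq_zero fun j hj => ?_
  have hj := (hB j (by simpa using hj)).1
  rw [geom, if_neg fun h => by omega, mul_zero]

theorem orbitSize_le_of_iterate_eq {X : Type*} {f : X → X} {x : X} {t ℓ : ℕ} (hℓ : ℓ ≠ 0)
    (h : f^[t + ℓ] x = f^[t] x) : orbitSize f x ≤ ((t + ℓ : ℕ) : ℕ∞) := by
  have hsub : (Set.range fun n : ℕ => f^[n] x) ⊆
      (fun n : ℕ => f^[n] x) '' (Finset.range (t + ℓ) : Set ℕ) := by
    rintro _ ⟨n, rfl⟩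
    induction n using Nat.strong_induction_on with
    | _ n ih =>
      by_cases hn : n < t + ℓ
      · exact ⟨n, by simpa using hn, rfl⟩
      · obtain ⟨d, rfl⟩ := Nat.exists_eq_add_of_le (not_lt.mp hn)
        have heq : f^[t + ℓ + d] x = f^[t + d] x := by
          rw [add_comm (t + ℓ), Function.iterate_add_apply, h, ← Function.iterate_add_apply,
            add_comm]
        have := ih (t + d) (by omega)
        simpa only [heq] using this
  refine (Set.encard_le_encard hsub).trans ((Set.encard_image_le _ _).trans ?_)
  rw [Set.encard_coe_eq_coe_finsetCard, Finset.card_range]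

theorem lambda0_iterate_eq {p : ℕ} [Fact p.Prime] {α : ℕ} (hα : α ≠ 0)
    {R K S : (ZMod (p ^ α))[T;T⁻¹]} {t ℓ : ℕ} (hℓ : ℓ ≠ 0)
    (hK : R ^ p ^ (α - 1) * K = T (((p : ℤ) ^ ℓ - 1) * (p : ℤ) ^ t) - 1) {a : ℤ}
    (ha : -(p : ℤ) ^ t < a) (hs : SuppIn a (((p : ℤ) ^ ℓ - 1) * (p : ℤ) ^ t) (S * K)) :
    (lambda0 p α R)^[t + ℓ] S = (lambda0 p α R)^[t] S := by
  have hp : 1 < (p : ℤ) := by exact_mod_cast Nat.Prime.one_lt Fact.out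
  set L := ((p : ℤ) ^ ℓ - 1) * (p : ℤ) ^ t with hLdef
  have hpt : 0 < (p : ℤ) ^ t := by positivity
  have hpl : 1 < (p : ℤ) ^ ℓ := one_lt_pow₀ hp hℓ
  have hL : 0 < L := mul_pos (by linarith) hpt
  set F := act (ZMod (p ^ α)) (S * K) (geom _ L) with hFdef
  have hF : act _ (R ^ p ^ (α - 1)) F = S.coeff := by
    rw [hFdef, ← act_mul, mul_left_comm, hK, act_mul, act_T_sub_one_geom hL, act_coeff, mul_one]
  have hperiod : (fun m => F ((p : ℤ) ^ (t + ℓ) * m)) = fun m => F ((p : ℤ) ^ t * m) := by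
    funext m
    rw [pow_add]
    -- Negative `m` give exponents at most `-p ^ t`, below the support; positive `m` lie in the
    -- periodic range; `m = 0` is fixed by decimation, so no periodicity is needed there.
    rcases lt_trichotomy m 0 with hm | rfl | hm
    · have h1 : (p : ℤ) ^ t * m < a := by nlinarith
      have h2 : (p : ℤ) ^ t * (p : ℤ) ^ ℓ * m < a := by nlinarith
      rw [hFdef, act_geom_eq_zero hs h1, act_geom_eq_zero hs h2]
    · simp
    · refine (act_geom_eq hs ?_ ?_ ⟨m, ?_⟩).symm
      · rw [sub_self]; positivity
      · rw [sub_self]; positivity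
      · rw [hLdef]; ring
  apply AddMonoidAlgebra.coeff_injective
  apply DFunLike.coe_injective
  rw [← act_lambda0_iterate hα R S F hF, ← act_lambda0_iterate hα R S F hF, hperiod]

end Orbit

end CartierOrbit

theorem mainTheorem7 (p : ℕ) [Fact p.Prime] (α : ℕ) (hα : α ≠ 0)
    -- `R ∈ z⁻¹ (ℤ/p^α)[z]`
    (R : (ZMod (p ^ α))[T;T⁻¹])
    (hR : ∃ A : Polynomial (ZMod (p ^ α)),
      R = LaurentPolynomial.T (-1) * Polynomial.toLaurent A)
    -- the factorization of `R mod p`, in particular `R mod p ≠ 0`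
    (c : ZMod p) (e₀ : ℤ) (k : ℕ) (P : Fin k → Polynomial (ZMod p)) (e : Fin k → ℕ)
    (hfac : CartierOrbit.IsFactorization (CartierOrbit.modP p hα R) c e₀ P e)
    -- `r = deg (R mod p)`
    (r : ℤ) (hr : (CartierOrbit.modP p hα R).degree = (r : WithBot ℤ))
    (S : (ZMod (p ^ α))[T;T⁻¹])
    (hmin : ((1 - (p : ℤ) ^ (α - 1) : ℤ) : WithTop ℤ) ≤ CartierOrbit.mindeg S)
    (hdeg : S.degree ≤ (((p : ℤ) ^ (α - 1) * r : ℤ) : WithBot ℤ)) :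
    CartierOrbit.orbitSize (CartierOrbit.lambda0 p α R) S ≤
      ((CartierOrbit.transient p α e₀ e +
        Finset.univ.lcm (fun i => (P i).natDegree) : ℕ) : ℕ∞) := by
  have hℓ0 : Finset.univ.lcm (fun i => (P i).natDegree) ≠ 0 := by
    rw [Ne, Finset.lcm_eq_zero_iff]
    rintro ⟨i, -, hi⟩
    exact (hfac.irreducible i).natDegree_pos.ne' hi
  refine CartierOrbit.orbitSize_le_of_iterate_eq hℓ0 ?_
  obtain ⟨K, hKs, hK⟩ := CartierOrbit.exists_cofactor hα hfac hr le_rfl hℓ0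
    fun i => Finset.dvd_lcm (Finset.mem_univ i)
  obtain ⟨-, -, ht⟩ := CartierOrbit.transient_spec p α hα e₀ e le_rfl
  -- The exponents of `S * K` start at `1 - p ^ (α - 1) * (e₀ + 1) > -p ^ t` or later; at the top
  -- the terms `p ^ (α - 1) * r` cancel, leaving `L`.
  exact CartierOrbit.lambda0_iterate_eq hα hℓ0 hK (by linarith)
    (((CartierOrbit.SuppIn.of_mindeg_of_degree hmin hdeg).mul hKs).mono le_rfl (by linarith))
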